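/- Let $\sigma_0=I$, $\sigma_1=\begin{pmatrix}1&0\\0&-1\end{pmatrix}$, $\sigma_2=\begin{pmatrix}0&1\\1&0\end{pmatrix}$, $\sigma_3=\begin{pmatrix}0&-i\\i&0\end{pmatrix}$, and let $|\Psi_i\rangle=(I\otimes\sigma_i)\frac{1}{\sqrt2}(|00\rangle+|11\rangle)$, $0\le i\le 3$, be the Bell states. Let $\mathrm S=\{|\chi_0\rangle,\dots,|\chi_3\rangle\}$ be the set of states shared by Alice (holding $A_0A_1$) and Bob (holding $B_0B_1$) given by $$|\chi_0\rangle=|\Psi_0\rangle_{A_0B_0}\otimes|\Psi_0\rangle_{A_1B_1},\qquad |\chi_i\rangle=|\Psi_i\rangle_{A_0B_0}\otimes|\Psi_1\rangle_{A_1B_1}\quad(i=1,2,3).$$ For $0<\delta<1/2$ let $|\beta\rangle=\sqrt{1-\delta}\,|00\rangle+\sqrt{\delta}\,|11\rangle$, shared between Alice and Bob, and $\mathrm K=\mathrm K_\delta=\mathrm S\otimes\{|\beta\rangle\}=\{|\chi_i\rangle\otimes|\beta\rangle:0\le i\le3\}$. For $m\geq 1$ let $\mathrm K^{\otimes m}$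 be the set of all $m$-fold tensor products of elements of $\mathrm K$, where Alice holds all her parts and Bob all of his. States $\{|\varphi_i\rangle\}$ are (perfectly) distinguished by a POVM $(M_i)$ if $M_i|\varphi_i\rangle=|\varphi_i\rangle$ for all $i$. They are PPT distinguishable if this holds for some POVM all of whose elements have positive semidefinite partial transpose, and LOCC distinguishable if it holds for some POVM that is realized by a protocol of finitely many rounds of local quantum operations and classical communication between Alice and Bob. 1. There is $\delta_0\in(0,1/2]$ such that for every $\delta\in(0,\delta_0)$ the set $\mathrm K_\delta$ is not PPT distinguishable, and hence not LOCC distinguishable. 2. For every $\delta\in(0,1/2)$, with $m=\left\lceil-\frac{1}{\log_2(1-\delta)}\right\rceil$, one has $m>1$, the set $\mathrm K_\delta^{\otimes m}$ consists of $4^m$ states, and it is LOCC distinguishable. -/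

import Mathlib

open scoped Kronecker ComplexOrder

noncomputable section

/-! Bipartite systems: Alice's space is `ℂ^α`, Bob's space is `ℂ^β` for finite index types `α`, `β`
(with their standard bases), pure states are vectors `α × β → ℂ` and operators on the bipartite
system are matrices indexed by `α × β`. -/

/-- The partial transpose with respect to Alice: `(|i j⟩⟨k l|)^Γ = |k j⟩⟨i l|`. -/
def partialTranspose {α β : Type} (M : Matrix (α × β) (α × β) ℂ) : Matrix (α × β) (α × β) ℂ :=
  Matrix.of fun p q => M (q.1, p.2) (p.1, q.2)

/-- A positive operator-valued measure with outcomes in `R`. -/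
def IsPOVM {R ι : Type} [Fintype R] [Fintype ι] [DecidableEq ι]
    (E : R → Matrix ι ι ℂ) : Prop :=
  (∀ r, (E r).PosSemidef) ∧ ∑ r, E r = 1

/-- A PPT POVM: every element has positive partial transpose. -/
def IsPPTPOVM {R α β : Type} [Fintype R] [Fintype α] [DecidableEq α] [Fintype β] [DecidableEq β]
    (E : R → Matrix (α × β) (α × β) ℂ) : Prop :=
  IsPOVM E ∧ ∀ r, (partialTranspose (E r)).PosSemidef

/-- `IsLOCCPOVM E`: the POVM `E` is realized by an LOCC protocol, i.e. by finitely many rounds in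
which one of the parties performs a local measurement (a finite family of Kraus operators, the
dimension of the local system being allowed to change) and communicates the outcome, on which the
rest of the protocol may depend.  At the end a result is announced.
* `announce r`: stop and announce the result `r`;
* `alice A`: Alice measures with Kraus operators `A j` and, after outcome `j`, the parties continue
  with an LOCC protocol realizing `M j`; result `r` then has the effect
  `∑ j, (A j ⊗ I)† (M j r) (A j ⊗ I)`;
* `bob B`: the same with the parties exchanged.
Unitaries, ancillas, discarding of subsystems and (shared) randomness are special cases. -/
inductive IsLOCCPOVM {R : Type} [DecidableEq R] :
    {α β : Type} → [Fintype α] → [DecidableEq α] → [Fintype β] → [DecidableEq β] →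
      (R → Matrix (α × β) (α × β) ℂ) → Prop
  | announce {α β : Type} [Fintype α] [DecidableEq α] [Fintype β] [DecidableEq β] (r : R) :
      IsLOCCPOVM (fun s => if s = r then (1 : Matrix (α × β) (α × β) ℂ) else 0)
  | alice {α α' β : Type} [Fintype α] [DecidableEq α] [Fintype α'] [DecidableEq α']
      [Fintype β] [DecidableEq β] {k : ℕ} (A : Fin k → Matrix α' α ℂ)
      (hA : ∑ j, (A j).conjTranspose * A j = 1)
      (M : Fin k → R → Matrix (α' × β) (α' × β) ℂ) (hM : ∀ j, IsLOCCPOVM (M j)) :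
      IsLOCCPOVM (fun s => ∑ j,
        (A j ⊗ₖ (1 : Matrix β β ℂ)).conjTranspose * M j s * (A j ⊗ₖ (1 : Matrix β β ℂ)))
  | bob {α β β' : Type} [Fintype α] [DecidableEq α] [Fintype β] [DecidableEq β]
      [Fintype β'] [DecidableEq β'] {k : ℕ} (B : Fin k → Matrix β' β ℂ)
      (hB : ∑ j, (B j).conjTranspose * B j = 1)
      (M : Fin k → R → Matrix (α × β') (α × β') ℂ) (hM : ∀ j, IsLOCCPOVM (M j)) :
      IsLOCCPOVM (fun s => ∑ j,
        ((1 : Matrix α α ℂ) ⊗ₖ B j).conjTranspose * M j s * ((1 : Matrix α α ℂ) ⊗ₖ B j))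

/-- The operators `E r` identify the states `ψ r` without error: `E r |ψ r⟩ = |ψ r⟩`. -/
def Identifies {R ι : Type} [Fintype ι] (E : R → Matrix ι ι ℂ) (ψ : R → ι → ℂ) : Prop :=
  ∀ r, (E r).mulVec (ψ r) = ψ r

/-- Perfect distinguishability by a PPT POVM. -/
def PPTDistinguishable {R α β : Type} [Fintype R]
    [Fintype α] [DecidableEq α] [Fintype β] [DecidableEq β] (ψ : R → α × β → ℂ) : Prop :=
  ∃ E : R → Matrix (α × β) (α × β) ℂ, IsPPTPOVM E ∧ Identifies E ψ

/-- Perfect distinguishability by LOCC. -/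
def LOCCDistinguishable {R α β : Type} [DecidableEq R]
    [Fintype α] [DecidableEq α] [Fintype β] [DecidableEq β] (ψ : R → α × β → ℂ) : Prop :=
  ∃ E : R → Matrix (α × β) (α × β) ℂ, IsLOCCPOVM E ∧ Identifies E ψ

/-- The tensor product of two bipartite states, regrouped as a bipartite state in which Alice
holds both first halves and Bob holds both second halves. -/
def bipTensor {α β α' β' : Type} (ψ : α × β → ℂ) (φ : α' × β' → ℂ) :
    (α × α') × (β × β') → ℂ :=
  fun p => ψ (p.1.1, p.2.1) * φ (p.1.2, p.2.2)

/-- The `m`-th tensor power of an indexed set of bipartite states: all products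
`ψ (i 0) ⊗ ⋯ ⊗ ψ (i (m - 1))`, where Alice holds all first halves and Bob all second halves. -/
def bipTensorPower {R α β : Type} (ψ : R → α × β → ℂ) (m : ℕ) :
    (Fin m → R) → (Fin m → α) × (Fin m → β) → ℂ :=
  fun i p => ∏ t, ψ (i t) (p.1 t, p.2 t)

/-- The two-qubit basis vector `|a b⟩`. -/
def ket (a b : Fin 2) : Fin 2 × Fin 2 → ℂ := Pi.single (a, b) 1

/-- The Pauli matrices, in the order `I, Z, X, Y`. -/
def pauli : Fin 4 → Matrix (Fin 2) (Fin 2) ℂ :=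
  ![1, !![1, 0; 0, -1], !![0, 1; 1, 0], !![0, -Complex.I; Complex.I, 0]]

/-- The Bell states `|Ψ_i⟩ = (I ⊗ σ_i) (|00⟩ + |11⟩) / √2`. -/
def bell (i : Fin 4) : Fin 2 × Fin 2 → ℂ :=
  ((1 : Matrix (Fin 2) (Fin 2) ℂ) ⊗ₖ pauli i).mulVec
    (((1 / Real.sqrt 2 : ℝ) : ℂ) • (ket 0 0 + ket 1 1))

/-- The four states of the set `S`. -/
def stateS : Fin 4 → (Fin 2 × Fin 2) × (Fin 2 × Fin 2) → ℂ :=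
  ![bipTensor (bell 0) (bell 0), bipTensor (bell 1) (bell 1),
    bipTensor (bell 2) (bell 1), bipTensor (bell 3) (bell 1)]

/-- `|β⟩ = √(1 - δ) |00⟩ + √δ |11⟩`. -/
def stateBeta (δ : ℝ) : Fin 2 × Fin 2 → ℂ :=
  ((Real.sqrt (1 - δ) : ℝ) : ℂ) • ket 0 0 + ((Real.sqrt δ : ℝ) : ℂ) • ket 1 1

/-- The four states of the set `K = S ⊗ {|β⟩}`. -/
def stateK (δ : ℝ) : Fin 4 → ((Fin 2 × Fin 2) × Fin 2) × ((Fin 2 × Fin 2) × Fin 2) → ℂ :=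
  fun i => bipTensor (stateS i) (stateBeta δ)

end

/-! ### LOCC measurements have positive partial transpose -/

/-! For the impossibility, LOCC measurements are PPT (`IsLOCCPOVM.isPPTPOVM`), so PPT suffices. A
measurement that is perfect on K almost identifies the states of S when compressed to the |00⟩
component of β: each success probability is at least 1 - δ/(1-δ) (`fidelity_of_mulVec_eq`). Weak
duality bounds the sum of these four probabilities by tr T = 7/2, where T dominates the partial
transpose of every χ_i (`dual_posSemidef`). This is a contradiction for small δ.

For the protocol, m copies of β have largest squared Schmidt coefficient (1-δ)^m ≤ 1/2, and such a
state can be converted into an ebit with certainty (`LOCCIdentifiable.concentrate`). The ebit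
identifies one χ_i, whose second pair is then a known Bell state and is rotated back into an ebit
(`LOCCIdentifiable.catalyze`). So a single ebit serves all m copies
(`LOCCIdentifiable.stateSPower`). Perfect discrimination of nonzero states also forces them to be
distinct, which gives the count 4^m. -/

theorem partialTranspose_sum {α β J : Type} [Fintype J] (M : J → Matrix (α × β) (α × β) ℂ) :
    partialTranspose (∑ j, M j) = ∑ j, partialTranspose (M j) := by
  ext p q
  simp [partialTranspose, Matrix.sum_apply]

theorem partialTranspose_one {α β : Type} [DecidableEq α] [DecidableEq β] :
    partialTranspose (1 : Matrix (α × β) (α × β) ℂ) = 1 := by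
  ext ⟨a, b⟩ ⟨a', b'⟩
  simp only [partialTranspose, Matrix.of_apply, Matrix.one_apply, Prod.mk.injEq]
  grind

/-- Transposing Alice's side exchanges the roles of A† and A, so the Kraus operator returns with
conjugated entries. The map is still a congruence and preserves positivity. -/
theorem partialTranspose_conj_alice {α α' β : Type} [Fintype α'] [Fintype β] [DecidableEq β]
    (A : Matrix α' α ℂ) (M : Matrix (α' × β) (α' × β) ℂ) :
    partialTranspose ((A ⊗ₖ (1 : Matrix β β ℂ)).conjTranspose * M * (A ⊗ₖ (1 : Matrix β β ℂ))) =
      (A.map star ⊗ₖ (1 : Matrix β β ℂ)).conjTranspose * partialTranspose M *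
        (A.map star ⊗ₖ (1 : Matrix β β ℂ)) := by
  ext ⟨a, b⟩ ⟨a', b'⟩
  simp only [partialTranspose, Matrix.of_apply, Matrix.mul_apply, Matrix.conjTranspose_apply,
    Matrix.kroneckerMap_apply, Matrix.one_apply, Fintype.sum_prod_type, Matrix.map_apply,
    Finset.sum_mul]
  simp only [mul_ite, mul_one, mul_zero, ite_mul, zero_mul, apply_ite star, star_zero,
    Finset.sum_ite_eq', Finset.mem_univ, if_true, star_star, Finset.sum_ite_irrel,
    Finset.sum_const_zero]
  rw [Finset.sum_comm]
  refine Finset.sum_congr rfl fun x _ => Finset.sum_congr rfl fun y _ => ?_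
  ring

theorem partialTranspose_conj_bob {α β β' : Type} [Fintype β'] [Fintype α] [DecidableEq α]
    (B : Matrix β' β ℂ) (M : Matrix (α × β') (α × β') ℂ) :
    partialTranspose (((1 : Matrix α α ℂ) ⊗ₖ B).conjTranspose * M * ((1 : Matrix α α ℂ) ⊗ₖ B)) =
      ((1 : Matrix α α ℂ) ⊗ₖ B).conjTranspose * partialTranspose M *
        ((1 : Matrix α α ℂ) ⊗ₖ B) := by
  ext ⟨a, b⟩ ⟨a', b'⟩
  simp only [partialTranspose, Matrix.of_apply, Matrix.mul_apply, Matrix.conjTranspose_apply,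
    Matrix.kroneckerMap_apply, Matrix.one_apply, Fintype.sum_prod_type, Finset.sum_mul]
  simp [apply_ite star, Finset.sum_ite_irrel]

theorem sum_conj_kraus {R ι κ J : Type} [Fintype R] [Fintype J] [Fintype ι] [DecidableEq ι]
    [Fintype κ] [DecidableEq κ] (K : J → Matrix κ ι ℂ) (hK : ∑ j, (K j).conjTranspose * K j = 1)
    (M : J → R → Matrix κ κ ℂ) (hM : ∀ j, ∑ r, M j r = 1) :
    ∑ r, ∑ j, (K j).conjTranspose * M j r * K j = 1 := by
  rw [Finset.sum_comm, ← hK]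
  refine Finset.sum_congr rfl fun j _ => ?_
  rw [← Matrix.sum_mul, ← Matrix.mul_sum, hM, Matrix.mul_one]

theorem sum_kraus_alice {α α' β J : Type} [Fintype J] [Fintype α'] [Fintype β] [DecidableEq α]
    [DecidableEq β] (A : J → Matrix α' α ℂ) (hA : ∑ j, (A j).conjTranspose * A j = 1) :
    ∑ j, (A j ⊗ₖ (1 : Matrix β β ℂ)).conjTranspose * (A j ⊗ₖ (1 : Matrix β β ℂ)) = 1 := by
  simp_rw [Matrix.conjTranspose_kronecker, ← Matrix.mul_kronecker_mul]
  rw [← Matrix.one_kronecker_one, ← hA]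
  ext p q
  simp [Matrix.sum_apply, Matrix.kroneckerMap_apply, Finset.sum_mul]

theorem sum_kraus_bob {α β β' J : Type} [Fintype J] [Fintype β'] [Fintype α] [DecidableEq α]
    [DecidableEq β] (B : J → Matrix β' β ℂ) (hB : ∑ j, (B j).conjTranspose * B j = 1) :
    ∑ j, ((1 : Matrix α α ℂ) ⊗ₖ B j).conjTranspose * ((1 : Matrix α α ℂ) ⊗ₖ B j) = 1 := by
  simp_rw [Matrix.conjTranspose_kronecker, ← Matrix.mul_kronecker_mul]
  rw [← Matrix.one_kronecker_one, ← hB]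
  ext p q
  simp [Matrix.sum_apply, Matrix.kroneckerMap_apply, Finset.mul_sum]

theorem IsLOCCPOVM.isPPTPOVM {R α β : Type} [Fintype R] [DecidableEq R] [Fintype α]
    [DecidableEq α] [Fintype β] [DecidableEq β] {E : R → Matrix (α × β) (α × β) ℂ}
    (h : IsLOCCPOVM E) : IsPPTPOVM E := by
  induction h with
  | announce r =>
    refine ⟨⟨fun s => ?_, by simp⟩, fun s => ?_⟩
    · dsimp only; split_ifs
      · exact Matrix.PosSemidef.one
      · exact Matrix.PosSemidef.zero
    · dsimp only; split_ifs
      · rw [partialTranspose_one]; exact Matrix.PosSemidef.one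
      · exact Matrix.PosSemidef.zero
  | alice A hA M hM ih =>
    refine ⟨⟨fun s => Matrix.posSemidef_sum _ fun j _ =>
        ((ih j).1.1 s).conjTranspose_mul_mul_same _, ?_⟩, fun s => ?_⟩
    · exact sum_conj_kraus _ (sum_kraus_alice A hA) M fun j => (ih j).1.2
    · rw [partialTranspose_sum]
      refine Matrix.posSemidef_sum _ fun j _ => ?_
      rw [partialTranspose_conj_alice]
      exact ((ih j).2 s).conjTranspose_mul_mul_same _
  | bob B hB M hM ih =>
    refine ⟨⟨fun s => Matrix.posSemidef_sum _ fun j _ =>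
        ((ih j).1.1 s).conjTranspose_mul_mul_same _, ?_⟩, fun s => ?_⟩
    · exact sum_conj_kraus _ (sum_kraus_bob B hB) M fun j => (ih j).1.2
    · rw [partialTranspose_sum]
      refine Matrix.posSemidef_sum _ fun j _ => ?_
      rw [partialTranspose_conj_bob]
      exact ((ih j).2 s).conjTranspose_mul_mul_same _

theorem LOCCDistinguishable.pptDistinguishable {R α β : Type} [Fintype R] [DecidableEq R]
    [Fintype α] [DecidableEq α] [Fintype β] [DecidableEq β] {ψ : R → α × β → ℂ}
    (h : LOCCDistinguishable ψ) : PPTDistinguishable ψ :=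
  let ⟨E, hE, hψ⟩ := h
  ⟨E, hE.isPPTPOVM, hψ⟩

/-- A POVM cannot identify the same nonzero vector with two results. -/
theorem IsPOVM.injective_of_identifies {R ι : Type} [Fintype R] [Fintype ι] [DecidableEq ι]
    {E : R → Matrix ι ι ℂ} (hE : IsPOVM E) {ψ : R → ι → ℂ} (h : Identifies E ψ)
    (hψ : ∀ r, ψ r ≠ 0) : Function.Injective ψ := by
  classical
  intro r s hrs
  by_contra hne
  have hsum : ∑ t, star (ψ r) ⬝ᵥ (E t).mulVec (ψ r) = star (ψ r) ⬝ᵥ ψ r := by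
    rw [← dotProduct_sum, ← Matrix.sum_mulVec, hE.2, Matrix.one_mulVec]
  -- The two outcomes r and s would each carry the full squared norm, while all outcomes together
  -- carry it only once.
  have hle : ∑ t ∈ {r, s}, star (ψ r) ⬝ᵥ (E t).mulVec (ψ r) ≤
      ∑ t, star (ψ r) ⬝ᵥ (E t).mulVec (ψ r) :=
    Finset.sum_le_univ_sum_of_nonneg fun t => (hE.1 t).dotProduct_mulVec_nonneg (ψ r)
  rw [hsum, Finset.sum_pair hne, h r, hrs, h s] at hle
  have hpos : 0 < star (ψ s) ⬝ᵥ ψ s := by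
    simpa using Matrix.PosDef.one.dotProduct_mulVec_pos (hψ s)
  have := (add_le_iff_nonpos_left (a := star (ψ s) ⬝ᵥ ψ s)).1 hle
  exact absurd hpos (not_lt_of_ge this)

/-! ### Protocols as successive transformations of the states -/

/-- A bipartite state given by its coefficient matrix. -/
def vectorize {α β : Type} (ψ : Matrix α β ℂ) : α × β → ℂ := fun p => ψ p.1 p.2

theorem kronecker_one_mulVec_vectorize {α α' β : Type} [Fintype α] [Fintype β] [DecidableEq β]
    (A : Matrix α' α ℂ) (ψ : Matrix α β ℂ) :
    (A ⊗ₖ (1 : Matrix β β ℂ)).mulVec (vectorize ψ) = vectorize (A * ψ) := by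
  ext p
  simp [Matrix.mulVec, dotProduct, Fintype.sum_prod_type, vectorize, Matrix.one_apply,
    Matrix.mul_apply]

theorem one_kronecker_mulVec_vectorize {α β β' : Type} [Fintype α] [Fintype β] [DecidableEq α]
    (B : Matrix β' β ℂ) (ψ : Matrix α β ℂ) :
    ((1 : Matrix α α ℂ) ⊗ₖ B).mulVec (vectorize ψ) = vectorize (ψ * B.transpose) := by
  ext p
  simp [Matrix.mulVec, dotProduct, Fintype.sum_prod_type, vectorize, Matrix.one_apply,
    Matrix.mul_apply, mul_comm]

/-- Some LOCC measurement gives the result `lab s` with certainty on the (unnormalized, possibly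
zero) state `ψ s`, for every `s`. -/
def LOCCIdentifiable {R S α β : Type} [DecidableEq R] [Fintype α] [DecidableEq α] [Fintype β]
    [DecidableEq β] (lab : S → R) (ψ : S → Matrix α β ℂ) : Prop :=
  ∃ E : R → Matrix (α × β) (α × β) ℂ, IsLOCCPOVM E ∧
    ∀ s, (E (lab s)).mulVec (vectorize (ψ s)) = vectorize (ψ s)

namespace LOCCIdentifiable

variable {R S S' α α' β β' J : Type} [DecidableEq R] [Fintype α] [DecidableEq α] [Fintype α']
  [DecidableEq α'] [Fintype β] [DecidableEq β] [Fintype β'] [DecidableEq β'] [Fintype J]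

/-- Identification is linear in the state: branches of probability zero impose no condition, and
normalization and phases are irrelevant. -/
theorem mono {lab : S → R} {lab' : S' → R} {ψ : S → Matrix α β ℂ} {φ : S' → Matrix α β ℂ}
    (h : LOCCIdentifiable lab' φ)
    (hψ : ∀ s, ψ s = 0 ∨ ∃ s' c, lab' s' = lab s ∧ ψ s = (c : ℂ) • φ s') :
    LOCCIdentifiable lab ψ := by
  obtain ⟨E, hE, hφ⟩ := h
  refine ⟨E, hE, fun s => ?_⟩
  obtain h0 | ⟨s', c, hl, hc⟩ := hψ s
  · have : vectorize (ψ s) = 0 := by rw [h0]; rfl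
    rw [this, Matrix.mulVec_zero]
  · have : vectorize (ψ s) = c • vectorize (φ s') := by rw [hc]; rfl
    rw [this, Matrix.mulVec_smul, ← hl, hφ]

theorem of_forall_eq {lab : S → R} (ψ : S → Matrix α β ℂ) (r : R)
    (h : ∀ s, ψ s = 0 ∨ lab s = r) : LOCCIdentifiable lab ψ := by
  refine ⟨_, IsLOCCPOVM.announce r, fun s => ?_⟩
  obtain h0 | h0 := h s
  · have : vectorize (ψ s) = 0 := by rw [h0]; rfl
    rw [this, Matrix.mulVec_zero]
  · simp [h0]

theorem mulVec_kraus {ι κ : Type} [Fintype ι] [DecidableEq ι] [Fintype κ] {k : ℕ}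
    (K : Fin k → Matrix κ ι ℂ) (hK : ∑ j, (K j).conjTranspose * K j = 1)
    (M : Fin k → Matrix κ κ ℂ) (v : ι → ℂ)
    (hM : ∀ j, (M j).mulVec ((K j).mulVec v) = (K j).mulVec v) :
    (∑ j, (K j).conjTranspose * M j * K j).mulVec v = v := by
  rw [Matrix.sum_mulVec]
  simp_rw [← Matrix.mulVec_mulVec, hM, Matrix.mulVec_mulVec]
  rw [← Matrix.sum_mulVec, hK, Matrix.one_mulVec]

theorem alice {lab : S → R} {ψ : S → Matrix α β ℂ} (A : J → Matrix α' α ℂ)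
    (hA : ∑ j, (A j).conjTranspose * A j = 1)
    (h : ∀ j, LOCCIdentifiable lab fun s => A j * ψ s) : LOCCIdentifiable lab ψ := by
  choose M hM hφ using h
  let e := (Fintype.equivFin J).symm
  have hA' : ∑ j, (A (e j)).conjTranspose * A (e j) = 1 := by
    rw [← hA]; exact e.sum_comp fun j => (A j).conjTranspose * A j
  refine ⟨_, IsLOCCPOVM.alice (fun j => A (e j)) hA' (fun j => M (e j)) fun j => hM (e j),
    fun s => ?_⟩
  refine mulVec_kraus _ (sum_kraus_alice _ hA') _ _ fun j => ?_
  rw [kronecker_one_mulVec_vectorize]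
  exact hφ (e j) s

theorem bob {lab : S → R} {ψ : S → Matrix α β ℂ} (B : J → Matrix β' β ℂ)
    (hB : ∑ j, (B j).conjTranspose * B j = 1)
    (h : ∀ j, LOCCIdentifiable lab fun s => ψ s * (B j).transpose) : LOCCIdentifiable lab ψ := by
  choose M hM hφ using h
  let e := (Fintype.equivFin J).symm
  have hB' : ∑ j, (B (e j)).conjTranspose * B (e j) = 1 := by
    rw [← hB]; exact e.sum_comp fun j => (B j).conjTranspose * B j
  refine ⟨_, IsLOCCPOVM.bob (fun j => B (e j)) hB' (fun j => M (e j)) fun j => hM (e j),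
    fun s => ?_⟩
  refine mulVec_kraus _ (sum_kraus_bob _ hB') _ _ fun j => ?_
  rw [one_kronecker_mulVec_vectorize]
  exact hφ (e j) s

/-- Relabelling a local basis is a unitary, that is, a measurement with a single outcome. -/
theorem of_submatrix {lab : S → R} {ψ : S → Matrix α β ℂ} (e : α' ≃ α) (f : β' ≃ β)
    (h : LOCCIdentifiable lab fun s => (ψ s).submatrix e f) : LOCCIdentifiable lab ψ := by
  have key : ∀ {γ γ' : Type} [Fintype γ] [DecidableEq γ] [Fintype γ'] [DecidableEq γ']
      (g : γ' ≃ γ), ∑ _j : Unit, ((1 : Matrix γ γ ℂ).submatrix g id).conjTranspose *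
        (1 : Matrix γ γ ℂ).submatrix g id = 1 := by
    intro γ γ' _ _ _ _ g
    simp only [Finset.univ_unique, Finset.sum_singleton, Matrix.conjTranspose_submatrix,
      Matrix.conjTranspose_one]
    rw [Matrix.submatrix_mul_equiv, Matrix.mul_one, Matrix.submatrix_id_id]
  refine alice (fun _ : Unit => (1 : Matrix α α ℂ).submatrix e id) (key e) fun _ => ?_
  refine bob (fun _ : Unit => (1 : Matrix β β ℂ).submatrix f id) (key f) fun _ => ?_
  convert h using 2 with s
  ext a b
  simp [Matrix.mul_apply, Matrix.one_apply]

end LOCCIdentifiable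

/-! ### Splitting a distribution into uniform pairs -/

/-- Lay the weights end to end as intervals I_x in [0, 1] and pair each t in [0, 1/2] with t + 1/2.
Then p x y is the length of the set of t in I_x with t + 1/2 in I_y. It vanishes for x = y since no
interval is longer than 1/2. -/
theorem exists_pair_weights_fin (N : ℕ) (w : Fin N → ℝ) (hw : ∀ x, 0 ≤ w x)
    (hsum : ∑ x, w x = 1) (hle : ∀ x, w x ≤ 1 / 2) :
    ∃ p : Fin N → Fin N → ℝ, (∀ x y, 0 ≤ p x y) ∧ (∀ x, p x x = 0) ∧
      ∀ x, ∑ y, (p x y + p y x) = w x := by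
  let v : ℕ → ℝ := fun k => if h : k < N then w ⟨k, h⟩ else 0
  have hv : ∀ k, 0 ≤ v k := fun k => by
    by_cases h : k < N
    · simpa [v, h] using hw _
    · simp [v, h]
  have hvle : ∀ k, v k ≤ 1 / 2 := fun k => by
    by_cases h : k < N
    · simpa [v, h] using hle ⟨k, h⟩
    · simp [v, h]
  let C : ℕ → ℝ := fun k => ∑ i ∈ Finset.range k, v i
  have hC : ∀ k, C (k + 1) = C k + v k := fun k => Finset.sum_range_succ _ _
  have hC0 : C 0 = 0 := rfl
  have hCN : C N = 1 := by
    rw [← hsum]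
    refine (Fin.sum_univ_eq_sum_range v N).symm.trans ?_
    exact Finset.sum_congr rfl fun i _ => by simp [v]
  have hCnn : ∀ k, 0 ≤ C k := fun k => Finset.sum_nonneg fun i _ => hv i
  have hCle : ∀ k, k ≤ N → C k ≤ 1 := fun k hk => by
    rw [← hCN]
    exact Finset.sum_le_sum_of_subset_of_nonneg (by simpa using hk) fun i _ _ => hv i
  -- `a` and `b` are the lengths of [0, C k] within the lower and the upper half of [0, 1]. `G i j`
  -- is the length of the t with t ≤ C i and t + 1/2 ≤ C j, and p is its mixed second difference.
  let a : ℕ → ℝ := fun k => min (C k) (1 / 2)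
  let b : ℕ → ℝ := fun k => max (C k - 1 / 2) 0
  let G : ℕ → ℕ → ℝ := fun i j => min (a i) (b j)
  have hGsum : ∀ i, ∑ j : Fin N, (G i (j + 1) - G i j) = a i := fun i => by
    rw [Fin.sum_univ_eq_sum_range (fun j => G i (j + 1) - G i j), Finset.sum_range_sub]
    have : 0 ≤ a i := le_min (hCnn i) (by norm_num)
    have h2 : a i ≤ 1 / 2 := min_le_right _ _
    simp only [G, b, hCN, hC0]
    norm_num
    grind
  have hGsum' : ∀ j, j ≤ N → ∑ i : Fin N, (G (i + 1) j - G i j) = b j := fun j hj => by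
    rw [Fin.sum_univ_eq_sum_range (fun i => G (i + 1) j - G i j), Finset.sum_range_sub fun i => G i j]
    have : 0 ≤ b j := le_max_right _ _
    have h2 : b j ≤ 1 / 2 := max_le (by linarith [hCle j hj]) (by norm_num)
    simp only [G, a, hCN, hC0]
    norm_num
    grind
  refine ⟨fun x y => (G (x + 1) (y + 1) - G (x + 1) y) - (G x (y + 1) - G x y), ?_, ?_, ?_⟩
  · intro x y
    have ha : a x ≤ a (x + 1) := by
      have := hC x; have := hv x; simp only [a]; grind
    have hb : b y ≤ b (y + 1) := by
      have := hC y; have := hv y; simp only [b]; grind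
    simp only [G]
    grind
  · intro x
    have h1 := hC x
    have h2 := hv x
    have h3 := hvle x
    have h4 := hCle (x + 1) (by omega)
    have h5 := hCnn x
    simp only [G, a, b]
    grind
  · intro x
    rw [Finset.sum_add_distrib, Finset.sum_sub_distrib, hGsum, hGsum]
    have : ∑ y : Fin N, (G (y + 1) (x + 1) - G (y + 1) x - (G y (x + 1) - G y x)) =
        b (x + 1) - b x := by
      rw [← hGsum' (x + 1) (by omega), ← hGsum' x (by omega), ← Finset.sum_sub_distrib]
      exact Finset.sum_congr rfl fun y _ => by ring
    rw [this]
    have h1 := hC x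
    have hx : v x = w x := by simp [v]
    simp only [a, b]
    grind

/-- A distribution with no weight above `1 / 2` is a mixture of uniform distributions on pairs. -/
theorem exists_pair_weights {ι : Type} [Fintype ι] (w : ι → ℝ) (hw : ∀ x, 0 ≤ w x)
    (hsum : ∑ x, w x = 1) (hle : ∀ x, w x ≤ 1 / 2) :
    ∃ p : ι → ι → ℝ, (∀ x y, 0 ≤ p x y) ∧ (∀ x, p x x = 0) ∧
      ∀ x, ∑ y, (p x y + p y x) = w x := by
  let e := Fintype.equivFin ι
  obtain ⟨p, h0, h1, h2⟩ := exists_pair_weights_fin _ (fun k => w (e.symm k)) (fun _ => hw _)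
    (by rw [← hsum]; exact e.symm.sum_comp w) fun _ => hle _
  refine ⟨fun x y => p (e x) (e y), fun _ _ => h0 _ _, fun _ => h1 _, fun x => ?_⟩
  have := h2 (e x)
  rw [Equiv.symm_apply_apply] at this
  rw [← this]
  exact e.sum_comp fun y => p (e x) y + p y (e x)

/-! ### Entanglement concentration -/

/-- The matrix `c₀ |0⟩⟨x| + c₁ |1⟩⟨y|`. -/
def pairMatrix {ι : Type} [DecidableEq ι] (c₀ c₁ : ℝ) (x y : ι) : Matrix (Fin 2) ι ℂ :=
  Matrix.of ![fun z => if z = x then (c₀ : ℂ) else 0, fun z => if z = y then (c₁ : ℂ) else 0]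

theorem pairMatrix_conjTranspose_mul_self {ι : Type} [Fintype ι] [DecidableEq ι] (c₀ c₁ : ℝ)
    (x y : ι) :
    (pairMatrix c₀ c₁ x y).conjTranspose * pairMatrix c₀ c₁ x y =
      Matrix.diagonal fun z => (((if z = x then c₀ ^ 2 else 0) +
        (if z = y then c₁ ^ 2 else 0) : ℝ) : ℂ) := by
  ext z z'
  simp only [Matrix.mul_apply, Fin.sum_univ_two, Matrix.conjTranspose_apply, pairMatrix,
    Matrix.of_apply, Matrix.cons_val_zero, Matrix.cons_val_one, Matrix.diagonal_apply]
  by_cases h : z = z'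
  · subst h
    simp only [if_true]
    split_ifs <;> simp [sq]
  · rw [if_neg h]
    have h1 : ¬ (z = x ∧ z' = x) := fun h' => h (h'.1.trans h'.2.symm)
    have h2 : ¬ (z = y ∧ z' = y) := fun h' => h (h'.1.trans h'.2.symm)
    split_ifs <;> simp_all

theorem pairMatrix_mul_diagonal {ι : Type} [Fintype ι] [DecidableEq ι] (c₀ c₁ : ℝ) (x y : ι)
    (d : ι → ℝ) :
    pairMatrix c₀ c₁ x y * Matrix.diagonal (fun z => (d z : ℂ)) =
      pairMatrix (c₀ * d x) (c₁ * d y) x y := by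
  ext i z
  rw [Matrix.mul_diagonal]
  fin_cases i <;> simp only [pairMatrix, Matrix.of_apply] <;> simp <;> grind

theorem pairMatrix_smul {ι : Type} [DecidableEq ι] (c : ℝ) (x y : ι) :
    pairMatrix c c x y = (c : ℂ) • pairMatrix 1 1 x y := by
  ext i z
  fin_cases i <;> simp [pairMatrix]

theorem pairMatrix_mul_transpose {ι : Type} [Fintype ι] [DecidableEq ι] {x y : ι} (h : x ≠ y) :
    pairMatrix 1 1 x y * (pairMatrix 1 1 x y).transpose = 1 := by
  ext i j
  fin_cases i <;> fin_cases j <;> simp [pairMatrix, Matrix.mul_apply, h, h.symm]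

theorem pairMatrix_mul_pairMatrix_transpose {ι : Type} [Fintype ι] [DecidableEq ι] {x y z : ι}
    (hx : z ≠ x) (hy : z ≠ y) (c : ℝ) :
    pairMatrix 1 1 x y * (pairMatrix c 0 z z).transpose = 0 := by
  ext i j
  fin_cases i <;> fin_cases j <;> simp [pairMatrix, Matrix.mul_apply, hx, hy]

/-- A shared state with all Schmidt coefficients at most `1 / 2` may be replaced by an ebit. -/
theorem LOCCIdentifiable.concentrate {R S γ ι : Type} [DecidableEq R] [Nonempty S] [Fintype γ]
    [DecidableEq γ] [Fintype ι] [DecidableEq ι] {lab : S → R} {ψ : S → Matrix γ γ ℂ} (w : ι → ℝ)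
    (hw : ∀ x, 0 < w x) (hsum : ∑ x, w x = 1) (hle : ∀ x, w x ≤ 1 / 2)
    (h : LOCCIdentifiable lab fun s => ψ s ⊗ₖ (1 : Matrix (Fin 2) (Fin 2) ℂ)) :
    LOCCIdentifiable lab fun s =>
      ψ s ⊗ₖ Matrix.diagonal fun x => ((Real.sqrt (w x) : ℝ) : ℂ) := by
  obtain ⟨p, hp0, hpd, hps⟩ := exists_pair_weights w (fun x => (hw x).le) hsum hle
  -- An arbitrary result, announced only in branches of probability zero.
  let r₀ : R := lab (Classical.arbitrary S)
  let c : ι → ι → ι → ℝ := fun x y z => Real.sqrt (p x y / w z)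
  have hc : ∀ x y z, c x y z ^ 2 = p x y / w z := fun x y z =>
    Real.sq_sqrt (div_nonneg (hp0 _ _) (hw _).le)
  have hcw : ∀ x y z, c x y z * Real.sqrt (w z) = Real.sqrt (p x y) := fun x y z => by
    rw [← Real.sqrt_mul (div_nonneg (hp0 _ _) (hw _).le), div_mul_cancel₀ _ (hw z).ne']
  -- The factors √(p x y / w z) cancel the Schmidt coefficients, so outcome (x, y) leaves a multiple
  -- of |0⟩|x⟩ + |1⟩|y⟩. Completeness is the marginal condition on p.
  let K : ι × ι → Matrix (Fin 2) ι ℂ := fun q =>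
    pairMatrix (c q.1 q.2 q.1) (c q.1 q.2 q.2) q.1 q.2
  have hK : ∑ q, (K q).conjTranspose * K q = 1 := by
    simp only [K, pairMatrix_conjTranspose_mul_self, hc]
    ext z z'
    rw [Matrix.sum_apply]
    simp only [Matrix.diagonal_apply, Matrix.one_apply]
    by_cases hz : z = z'
    · simp only [hz, if_true, Fintype.sum_prod_type]
      norm_cast
      simp only [Finset.sum_add_distrib]
      rw [Finset.sum_comm]
      simp only [Finset.sum_ite_eq, Finset.mem_univ, if_true]
      rw [← Finset.sum_add_distrib]
      simp_rw [← add_div]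
      rw [← Finset.sum_div, hps, div_self (hw _).ne']
    · simp [hz]
  refine LOCCIdentifiable.alice (fun q => (1 : Matrix γ γ ℂ) ⊗ₖ K q) (sum_kraus_bob K hK) ?_
  rintro ⟨x, y⟩
  simp_rw [← Matrix.mul_kronecker_mul, Matrix.one_mul]
  simp only [K, pairMatrix_mul_diagonal, hcw, pairMatrix_smul (Real.sqrt (p x y))]
  by_cases hxy : x = y
  · subst hxy
    refine LOCCIdentifiable.of_forall_eq _ r₀ fun s => Or.inl ?_
    simp [hpd]
  -- Bob maps x, y to 0, 1. The outcomes `some z` only complete the measurement and never occur.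
  let V : Option ι → Matrix (Fin 2) ι ℂ := fun o => o.elim (pairMatrix 1 1 x y) fun z =>
    pairMatrix (if z = x ∨ z = y then 0 else 1) 0 z z
  have hV : ∑ o, (V o).conjTranspose * V o = 1 := by
    simp only [V, Fintype.sum_option, Option.elim, pairMatrix_conjTranspose_mul_self]
    ext z z'
    rw [Matrix.add_apply, Matrix.sum_apply]
    simp only [Matrix.diagonal_apply, Matrix.one_apply]
    by_cases hz : z = z'
    · subst hz
      simp only [if_true]
      norm_cast
      simp
      grind
    · simp [hz]
  refine LOCCIdentifiable.bob (fun o => (1 : Matrix γ γ ℂ) ⊗ₖ V o) (sum_kraus_bob V hV) ?_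
  simp_rw [← Matrix.kroneckerMap_transpose, ← Matrix.mul_kronecker_mul, Matrix.transpose_one,
    Matrix.mul_one, Matrix.smul_mul]
  rintro (_ | z)
  · simp only [V, Option.elim, pairMatrix_mul_transpose hxy]
    exact h.mono fun s => Or.inr ⟨s, (Real.sqrt (p x y) : ℂ), rfl, Matrix.kronecker_smul _ _ _⟩
  · refine LOCCIdentifiable.of_forall_eq _ r₀ fun s => Or.inl ?_
    have : pairMatrix 1 1 x y * (V (some z)).transpose = 0 := by
      simp only [V, Option.elim]
      split_ifs with hz
      · ext i j
        fin_cases i <;> fin_cases j <;> simp [pairMatrix, Matrix.mul_apply]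
      · push Not at hz
        exact pairMatrix_mul_pairMatrix_transpose hz.1 hz.2 1
    rw [this, smul_zero, Matrix.kronecker_zero]

/-! ### Discriminating with an ebit as a catalyst -/

/-- The (unconjugated) dual vectors of the Bell basis. -/
noncomputable def bellBra (j : Fin 4) : Matrix Unit (Fin 2 × Fin 2) ℂ :=
  Matrix.of fun _ q => ((1 / Real.sqrt 2 : ℝ) : ℂ) * pauli j q.1 q.2

theorem inv_sqrt_two_mul_self : ((1 / Real.sqrt 2 : ℝ) : ℂ) * ((1 / Real.sqrt 2 : ℝ) : ℂ) = 1 / 2 := by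
  norm_cast
  rw [div_mul_div_comm, Real.mul_self_sqrt (by norm_num)]
  norm_num

theorem sum_pauli (x y x' y' : Fin 2) :
    ∑ j, star (pauli j x y) * pauli j x' y' = if (x, y) = (x', y') then 2 else 0 := by
  fin_cases x <;> fin_cases y <;> fin_cases x' <;> fin_cases y' <;>
    simp [Fin.sum_univ_four, pauli] <;> norm_num

theorem sum_bellBra : ∑ j, (bellBra j).conjTranspose * bellBra j = 1 := by
  ext ⟨x, y⟩ ⟨x', y'⟩
  rw [Matrix.sum_apply, Matrix.one_apply]
  have : ∀ j, ((bellBra j).conjTranspose * bellBra j) (x, y) (x', y') =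
      1 / 2 * (star (pauli j x y) * pauli j x' y') := fun j => by
    rw [← inv_sqrt_two_mul_self]
    simp [Matrix.mul_apply, bellBra]
    ring
  simp_rw [this]
  rw [← Finset.mul_sum, sum_pauli]
  split_ifs <;> simp

theorem bellBra_mul_mul (i j k : Fin 4) :
    bellBra j * ((pauli i).transpose ⊗ₖ (1 : Matrix (Fin 2) (Fin 2) ℂ)) * (bellBra k).transpose =
      Matrix.of fun _ _ =>
        1 / 2 * ∑ x, ∑ y, ∑ e, pauli j x e * pauli i y x * pauli k y e := by
  ext u v
  rw [← inv_sqrt_two_mul_self]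
  simp [Matrix.mul_apply, bellBra, Fintype.sum_prod_type, Matrix.one_apply, Fin.sum_univ_two]
  ring

/-- The amplitude is, up to a factor, the trace of σ_i σ_j σ_kᵀ. It vanishes unless σ_i is
proportional to σ_j σ_k, because transposition only changes signs. -/
theorem exists_forall_ne_bellBra (j k : Fin 4) : ∃ i₀, ∀ i, i ≠ i₀ →
    bellBra j * ((pauli i).transpose ⊗ₖ (1 : Matrix (Fin 2) (Fin 2) ℂ)) *
      (bellBra k).transpose = 0 := by
  have h : ∃ i₀, ∀ i, i ≠ i₀ →
      ∑ x, ∑ y, ∑ e, pauli j x e * pauli i y x * pauli k y e = 0 := by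
    -- The multiplication table of the Pauli matrices up to phase, a Klein four-group.
    refine ⟨![![0, 1, 2, 3], ![1, 0, 3, 2], ![2, 3, 0, 1], ![3, 2, 1, 0]] j k, fun i hi => ?_⟩
    fin_cases j <;> fin_cases k <;> fin_cases i <;>
      first
      | exact absurd rfl hi
      | simp [Fin.sum_univ_two, pauli]
  obtain ⟨i₀, h⟩ := h
  refine ⟨i₀, fun i hi => ?_⟩
  rw [bellBra_mul_mul, h i hi]
  ext
  simp

/-- The operator `σ_0` or `σ_1` that describes the second pair of the state `χ_i`. -/
def auxPauli (i : Fin 4) : Matrix (Fin 2) (Fin 2) ℂ := if i = 0 then pauli 0 else pauli 1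

theorem auxPauli_transpose (i : Fin 4) : (auxPauli i).transpose = auxPauli i := by
  unfold auxPauli
  split_ifs
  · simp [pauli]
  · ext a b; fin_cases a <;> fin_cases b <;> simp [pauli]

theorem auxPauli_conjTranspose (i : Fin 4) : (auxPauli i).conjTranspose = auxPauli i := by
  unfold auxPauli
  split_ifs
  · simp [pauli]
  · ext a b; fin_cases a <;> fin_cases b <;> simp [pauli]

theorem auxPauli_mul_self (i : Fin 4) : auxPauli i * auxPauli i = 1 := by
  unfold auxPauli
  split_ifs
  · simp [pauli]
  · ext a b; fin_cases a <;> fin_cases b <;> simp [pauli]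

/-- An ebit identifies `χ_i`, and the second pair of `χ_i` then serves as a new ebit. -/
theorem LOCCIdentifiable.catalyze {R S γ : Type} [DecidableEq R] [Fintype γ] [DecidableEq γ]
    {lab : Fin 4 × S → R} {ψ : S → Matrix γ γ ℂ}
    (h : ∀ i, LOCCIdentifiable (fun s => lab (i, s))
      fun s => ψ s ⊗ₖ (1 : Matrix (Fin 2) (Fin 2) ℂ)) :
    LOCCIdentifiable lab fun q =>
      ((pauli q.1).transpose ⊗ₖ (1 : Matrix (Fin 2) (Fin 2) ℂ)) ⊗ₖ (auxPauli q.1 ⊗ₖ ψ q.2) := by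
  refine LOCCIdentifiable.alice (fun j => bellBra j ⊗ₖ (1 : Matrix (Fin 2 × γ) (Fin 2 × γ) ℂ))
    (sum_kraus_alice _ sum_bellBra) fun j => ?_
  refine LOCCIdentifiable.bob (fun k => bellBra k ⊗ₖ (1 : Matrix (Fin 2 × γ) (Fin 2 × γ) ℂ))
    (sum_kraus_alice _ sum_bellBra) fun k => ?_
  simp_rw [← Matrix.kroneckerMap_transpose, ← Matrix.mul_kronecker_mul, Matrix.transpose_one,
    Matrix.mul_one, Matrix.one_mul]
  obtain ⟨i₀, hi₀⟩ := exists_forall_ne_bellBra j k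
  -- The outcomes j, k reveal i₀, so Bob undoes the known Pauli operator on the second pair and
  -- recovers an ebit.
  refine LOCCIdentifiable.bob
    (fun _ : Unit => (1 : Matrix Unit Unit ℂ) ⊗ₖ (auxPauli i₀ ⊗ₖ (1 : Matrix γ γ ℂ))) ?_ fun _ => ?_
  · rw [Finset.univ_unique, Finset.sum_singleton]
    simp_rw [Matrix.conjTranspose_kronecker, ← Matrix.mul_kronecker_mul, auxPauli_conjTranspose,
      auxPauli_mul_self, Matrix.conjTranspose_one, Matrix.mul_one, Matrix.one_kronecker_one]
  simp_rw [← Matrix.kroneckerMap_transpose, ← Matrix.mul_kronecker_mul, Matrix.transpose_one,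
    Matrix.mul_one, auxPauli_transpose]
  let e : γ × Fin 2 ≃ Unit × (Fin 2 × γ) := (Equiv.prodComm _ _).trans (Equiv.punitProd _).symm
  refine LOCCIdentifiable.of_submatrix e e ((h i₀).mono ?_)
  rintro ⟨i, s⟩
  by_cases hi : i = i₀
  · subst hi
    refine Or.inr ⟨s, (bellBra j * ((pauli i).transpose ⊗ₖ (1 : Matrix (Fin 2) (Fin 2) ℂ)) *
      (bellBra k).transpose) () (), rfl, ?_⟩
    ext ⟨a, x⟩ ⟨b, y⟩
    simp only [auxPauli_mul_self, Matrix.submatrix_apply, Matrix.kroneckerMap_apply,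
      Matrix.smul_apply, smul_eq_mul, e, Equiv.trans_apply, Equiv.prodComm_apply, Prod.swap,
      Equiv.punitProd_symm_apply]
    ring
  · left
    simp only [hi₀ i hi, Matrix.zero_kronecker]
    rfl

/-- The coefficient matrix of `χ_{i 0} ⊗ ⋯ ⊗ χ_{i (n - 1)}`, up to normalization. -/
def stateSPower (n : ℕ) (i : Fin n → Fin 4) :
    Matrix (Fin n → Fin 2 × Fin 2) (Fin n → Fin 2 × Fin 2) ℂ :=
  Matrix.of fun a b => ∏ t, (pauli (i t) (b t).1 (a t).1 * auxPauli (i t) (a t).2 (b t).2)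

/-- Splitting off the first of `n + 1` systems and moving an additional qubit next to its first
half. -/
def splitFirst (n : ℕ) : (Fin 2 × Fin 2) × (Fin 2 × (Fin n → Fin 2 × Fin 2)) ≃
    (Fin (n + 1) → Fin 2 × Fin 2) × Fin 2 where
  toFun p := (Fin.cons (p.1.1, p.2.1) p.2.2, p.1.2)
  invFun q := (((q.1 0).1, q.2), ((q.1 0).2, Fin.tail q.1))
  left_inv p := by simp
  right_inv q := by simp

/-- Induction on n, renewing the ebit at each step. The labelling is arbitrary because, once the
first index is known to be i, the rest is labelled by `lab (Fin.cons i s)`. -/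
theorem LOCCIdentifiable.stateSPower {R : Type} [DecidableEq R] (n : ℕ) :
    ∀ lab : (Fin n → Fin 4) → R, LOCCIdentifiable lab
      fun i => stateSPower n i ⊗ₖ (1 : Matrix (Fin 2) (Fin 2) ℂ) := by
  induction n with
  | zero =>
    exact fun lab => .of_forall_eq _ (lab default) fun s =>
      Or.inr (congrArg lab (Subsingleton.elim _ _))
  | succ n ih =>
    intro lab
    refine .of_submatrix (splitFirst n) (splitFirst n) ?_
    refine (LOCCIdentifiable.catalyze (lab := fun q => lab (Fin.cons q.1 q.2)) fun i =>
      ih fun s => lab (Fin.cons i s)).mono fun i => Or.inr ⟨(i 0, Fin.tail i), 1, by simp, ?_⟩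
    ext ⟨⟨x, e⟩, y, a⟩ ⟨⟨x', e'⟩, y', a'⟩
    simp only [splitFirst, _root_.stateSPower, Matrix.submatrix_apply, Equiv.coe_fn_mk,
      Matrix.kroneckerMap_apply, Matrix.of_apply, Fin.prod_univ_succ, Fin.cons_zero, Fin.cons_succ,
      one_smul, Matrix.transpose_apply, Fin.tail]
    ring

/-! ### The states of the theorem -/

theorem bell_apply (i : Fin 4) (a b : Fin 2) :
    bell i (a, b) = ((1 / Real.sqrt 2 : ℝ) : ℂ) * pauli i b a := by
  fin_cases a <;> fin_cases b <;>
  simp [bell, ket, Matrix.mulVec, dotProduct, Fintype.sum_prod_type, Matrix.one_apply,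
    Fin.sum_univ_two, Pi.single_apply, mul_comm]

theorem stateS_apply (i : Fin 4) (x y x' y' : Fin 2) :
    stateS i ((x, y), (x', y')) = 1 / 2 * (pauli i x' x * auxPauli i y y') := by
  have h : stateS i ((x, y), (x', y')) =
      bell i (x, x') * bell (if i = 0 then 0 else 1) (y, y') := by
    fin_cases i <;> rfl
  have h2 : pauli (if i = 0 then 0 else 1) = (auxPauli i).transpose := by
    rw [auxPauli_transpose]
    split_ifs with hi <;> simp [auxPauli, hi]
  rw [h, bell_apply, bell_apply, h2, ← inv_sqrt_two_mul_self, Matrix.transpose_apply]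
  ring

/-- The squared Schmidt coefficients of `|β⟩`. -/
def betaWeight (δ : ℝ) (z : Fin 2) : ℝ := if z = 0 then 1 - δ else δ

theorem stateBeta_apply (δ : ℝ) (z z' : Fin 2) :
    stateBeta δ (z, z') = if z = z' then ((Real.sqrt (betaWeight δ z) : ℝ) : ℂ) else 0 := by
  fin_cases z <;> fin_cases z' <;> simp [stateBeta, ket, betaWeight]

theorem stateK_apply (δ : ℝ) (i : Fin 4) (x y z x' y' z' : Fin 2) :
    stateK δ i (((x, y), z), ((x', y'), z')) = 1 / 2 * (pauli i x' x * auxPauli i y y') *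
      if z = z' then ((Real.sqrt (betaWeight δ z) : ℝ) : ℂ) else 0 := by
  rw [← stateS_apply, ← stateBeta_apply]
  rfl

theorem stateK_ne_zero {δ : ℝ} (hδ : δ < 1) (i : Fin 4) : ∃ p, stateK δ i p ≠ 0 := by
  have h : ((Real.sqrt (betaWeight δ 0) : ℝ) : ℂ) ≠ 0 := by
    have : 0 < Real.sqrt (betaWeight δ 0) := Real.sqrt_pos.2 (by simp [betaWeight, hδ])
    exact_mod_cast this.ne'
  have key : ∀ x x', pauli i x' x ≠ 0 → ∃ p, stateK δ i p ≠ 0 := fun x x' hx => by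
    refine ⟨(((x, 0), 0), ((x', 0), 0)), ?_⟩
    rw [stateK_apply, if_pos rfl]
    refine mul_ne_zero (mul_ne_zero (by norm_num) (mul_ne_zero hx ?_)) h
    unfold auxPauli
    split_ifs <;> simp [pauli]
  fin_cases i
  · exact key 0 0 (by simp [pauli])
  · exact key 0 0 (by simp [pauli])
  · exact key 0 1 (by simp [pauli])
  · exact key 0 1 (by simp [pauli])

theorem bipTensorPower_ne_zero {R α β : Type} {ψ : R → α × β → ℂ} (h : ∀ r, ∃ p, ψ r p ≠ 0)
    (m : ℕ) (i : Fin m → R) : bipTensorPower ψ m i ≠ 0 := by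
  choose p hp using h
  intro h0
  have := congrFun h0 (fun t => (p (i t)).1, fun t => (p (i t)).2)
  exact (Finset.prod_ne_zero_iff.2 fun t _ => hp (i t)) this

theorem LOCCDistinguishable.of_identifiable {R α β : Type} [DecidableEq R] [Fintype α]
    [DecidableEq α] [Fintype β] [DecidableEq β] {ψ : R → α × β → ℂ}
    (h : LOCCIdentifiable id fun r => Matrix.of fun a b => ψ r (a, b)) : LOCCDistinguishable ψ := h

theorem locc_bipTensorPower_stateK {δ : ℝ} (h0 : 0 < δ) (h1 : δ < 1 / 2) {m : ℕ}
    (hm : (1 - δ) ^ m ≤ 1 / 2) : LOCCDistinguishable (bipTensorPower (stateK δ) m) := by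
  apply LOCCDistinguishable.of_identifiable
  have hpos : ∀ z, 0 < betaWeight δ z := fun z => by
    unfold betaWeight; split_ifs <;> linarith
  let w : (Fin m → Fin 2) → ℝ := fun x => ∏ t, betaWeight δ (x t)
  have hw : ∀ x, 0 < w x := fun x => Finset.prod_pos fun t _ => hpos _
  have hsum : ∑ x, w x = 1 := by
    have := Finset.prod_univ_sum (fun _ : Fin m => (Finset.univ : Finset (Fin 2)))
      (fun _ z => betaWeight δ z)
    rw [Fintype.piFinset_univ] at this
    rw [← this]
    simp [betaWeight]
  -- Since δ < 1 - δ, the largest weight is that of the all-zero string, (1-δ)^m.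
  have hle : ∀ x, w x ≤ 1 / 2 := fun x => by
    refine le_trans (Finset.prod_le_prod (g := fun _ => 1 - δ) (fun t _ => (hpos _).le)
      fun t _ => ?_) (by simpa using hm)
    unfold betaWeight; split_ifs <;> linarith
  have h := LOCCIdentifiable.concentrate w hw hsum hle
    (LOCCIdentifiable.stateSPower m (id : (Fin m → Fin 4) → Fin m → Fin 4))
  let e := (Equiv.arrowProdEquivProdArrow (Fin m) (fun _ => Fin 2 × Fin 2) fun _ => Fin 2).symm
  -- Each χ_i contributes 1/2, the product of two Bell normalizations 1/√2.
  refine .of_submatrix e e (h.mono fun i => Or.inr ⟨i, (1 / 2) ^ m, rfl, ?_⟩)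
  ext ⟨a, z⟩ ⟨b, z'⟩
  have hz : Matrix.diagonal (fun x => ((Real.sqrt (w x) : ℝ) : ℂ)) z z' =
      ∏ t, if z t = z' t then ((Real.sqrt (betaWeight δ (z t)) : ℝ) : ℂ) else 0 := by
    rw [Matrix.diagonal_apply]
    split_ifs with hzz
    · subst hzz
      simp only [if_true, w]
      rw [Real.sqrt_prod _ fun t _ => (hpos _).le]
      push_cast
      rfl
    · obtain ⟨t, ht⟩ := Function.ne_iff.1 hzz
      exact (Finset.prod_eq_zero (Finset.mem_univ t) (if_neg ht)).symm
  rw [Matrix.smul_apply, Matrix.kroneckerMap_apply, hz]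
  have : ((1 : ℂ) / 2) ^ m = ∏ _t : Fin m, (1 / 2) := by simp
  rw [this, stateSPower, Matrix.of_apply, smul_eq_mul, ← mul_assoc, ← Finset.prod_mul_distrib,
    ← Finset.prod_mul_distrib]
  change ∏ t, stateK δ (i t) (e (a, z) t, e (b, z') t) = _
  exact Finset.prod_congr rfl fun t _ =>
    stateK_apply δ (i t) (a t).1 (a t).2 (z t) (b t).1 (b t).2 (z' t)

theorem ncard_range_bipTensorPower_stateK {δ : ℝ} (h0 : 0 < δ) (h1 : δ < 1 / 2) {m : ℕ}
    (hm : (1 - δ) ^ m ≤ 1 / 2) : (Set.range (bipTensorPower (stateK δ) m)).ncard = 4 ^ m := by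
  obtain ⟨E, hE, hψ⟩ := locc_bipTensorPower_stateK h0 h1 hm
  rw [Set.ncard_range_of_injective (hE.isPPTPOVM.1.injective_of_identifies hψ
    (bipTensorPower_ne_zero (stateK_ne_zero (by linarith)) m))]
  simp

/-- From 1/2 < 1 - δ < 1 the logarithm lies strictly between -1 and 0, so the quotient exceeds 1. -/
theorem one_lt_copies {δ : ℝ} (h0 : 0 < δ) (h1 : δ < 1 / 2) :
    1 < ⌈-1 / Real.logb 2 (1 - δ)⌉₊ := by
  have hneg : Real.logb 2 (1 - δ) < 0 := Real.logb_neg (by norm_num) (by linarith) (by linarith)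
  have hlt : -1 < Real.logb 2 (1 - δ) := by
    rw [Real.lt_logb_iff_rpow_lt (by norm_num) (by linarith), Real.rpow_neg_one]
    linarith
  rw [Nat.lt_ceil, Nat.cast_one, lt_div_iff_of_neg hneg]
  linarith

theorem pow_copies_le {δ : ℝ} (h0 : 0 < δ) (h1 : δ < 1 / 2) :
    (1 - δ) ^ ⌈-1 / Real.logb 2 (1 - δ)⌉₊ ≤ 1 / 2 := by
  have hneg : Real.logb 2 (1 - δ) < 0 := Real.logb_neg (by norm_num) (by linarith) (by linarith)
  have h := Nat.le_ceil (-1 / Real.logb 2 (1 - δ))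
  set m := ⌈-1 / Real.logb 2 (1 - δ)⌉₊
  rw [div_le_iff_of_neg hneg] at h
  have hp : (0 : ℝ) < (1 - δ) ^ m := pow_pos (by linarith) _
  have : Real.logb 2 ((1 - δ) ^ m) ≤ -1 := by rw [Real.logb_pow]; exact h
  rw [Real.logb_le_iff_le_rpow (by norm_num) hp, Real.rpow_neg_one] at this
  linarith

/-! ### A dual certificate against measurements with positive partial transpose -/

theorem Matrix.PosSemidef.trace_mul_nonneg {ι : Type} [Fintype ι] [DecidableEq ι]
    {M N : Matrix ι ι ℂ} (hM : M.PosSemidef) (hN : N.PosSemidef) : 0 ≤ (M * N).trace := by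
  obtain ⟨B, rfl⟩ : ∃ B : Matrix ι ι ℂ, N = B.conjTranspose * B := by
    open scoped MatrixOrder in
    exact CStarAlgebra.nonneg_iff_eq_star_mul_self.1 hN.nonneg
  rw [← Matrix.mul_assoc, Matrix.trace_mul_comm, ← Matrix.mul_assoc]
  exact (hM.mul_mul_conjTranspose_same B).trace_nonneg

/-- The projection onto a Bell state. -/
noncomputable def bellProj (i : Fin 4) : Matrix (Fin 2 × Fin 2) (Fin 2 × Fin 2) ℂ :=
  Matrix.vecMulVec (bell i) (star (bell i))

theorem bellProj_apply (i : Fin 4) (a b a' b' : Fin 2) :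
    bellProj i (a, b) (a', b') = 1 / 2 * (pauli i b a * star (pauli i b' a')) := by
  rw [← inv_sqrt_two_mul_self, bellProj, Matrix.vecMulVec_apply, Pi.star_apply, bell_apply,
    bell_apply, star_mul']
  rw [show star ((1 / Real.sqrt 2 : ℝ) : ℂ) = ((1 / Real.sqrt 2 : ℝ) : ℂ) from Complex.conj_ofReal _]
  ring

theorem bellProj_posSemidef (i : Fin 4) : (bellProj i).PosSemidef :=
  Matrix.posSemidef_vecMulVec_self_star _

theorem sum_bellProj : bellProj 0 + bellProj 1 + bellProj 2 + bellProj 3 = 1 := by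
  rw [← Fin.sum_univ_four]
  ext ⟨a, b⟩ ⟨a', b'⟩
  rw [Matrix.sum_apply, Matrix.one_apply]
  simp_rw [bellProj_apply]
  rw [← Finset.mul_sum]
  simp_rw [mul_comm (pauli _ b a)]
  rw [sum_pauli]
  simp only [Prod.mk.injEq]
  split_ifs <;> grind

/-- For i = 0 the left side is half the swap, which is 1/2 minus the singlet projection (index 3).
Conjugation by σ_i on Bob's side commutes with Alice's transposition and sends 3 to the index of σ_i
σ_3, which is 3 - i. -/
theorem partialTranspose_bellProj (i : Fin 4) :
    partialTranspose (bellProj i) = (1 / 2 : ℂ) • 1 - bellProj i.rev := by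
  ext ⟨a, b⟩ ⟨a', b'⟩
  simp only [partialTranspose, Matrix.of_apply, Matrix.sub_apply, Matrix.smul_apply,
    bellProj_apply, Matrix.one_apply]
  fin_cases i <;> fin_cases a <;> fin_cases b <;> fin_cases a' <;> fin_cases b' <;>
    simp [pauli, Fin.rev]

/-- The index of the second Bell pair of `χ_i`. -/
def auxIndex (i : Fin 4) : Fin 4 := if i = 0 then 0 else 1

/-- Twice the operator is the sum of the products P_j ⊗ P_k in which exactly one of j = 3 - i and k
= 3 - `auxIndex i` holds, minus P_3 ⊗ P_2. The pair (3, 2) is the only one occurring in that sum for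
all four i, so it can always be subtracted. This lowers the trace from the trivial bound 4 to 7/2.
-/
theorem dual_posSemidef (i : Fin 4) :
    ((1 / 4 : ℂ) • 1 - (1 / 2 : ℂ) • bellProj 3 ⊗ₖ bellProj 2 -
      partialTranspose (bellProj i) ⊗ₖ partialTranspose (bellProj (auxIndex i))).PosSemidef := by
  have hk : ∀ i j, (bellProj i ⊗ₖ bellProj j).PosSemidef := fun i j =>
    (bellProj_posSemidef i).kronecker (bellProj_posSemidef j)
  have expand : ∀ P P' : Matrix (Fin 2 × Fin 2) (Fin 2 × Fin 2) ℂ,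
      ((1 / 4 : ℂ) • 1 - (1 / 2 : ℂ) • bellProj 3 ⊗ₖ bellProj 2 -
        ((1 / 2 : ℂ) • 1 - P) ⊗ₖ ((1 / 2 : ℂ) • 1 - P')) =
      (1 / 2 : ℂ) • (P ⊗ₖ (1 - P') + (1 - P) ⊗ₖ P' - bellProj 3 ⊗ₖ bellProj 2) := fun P P' => by
    rw [← Matrix.one_kronecker_one]
    ext p q
    simp only [Matrix.sub_apply, Matrix.smul_apply, Matrix.add_apply, Matrix.kroneckerMap_apply,
      smul_eq_mul]
    ring
  rw [partialTranspose_bellProj, partialTranspose_bellProj, expand]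
  refine Matrix.PosSemidef.smul ?_ (by positivity)
  rw [← sum_bellProj]
  fin_cases i
  · convert (((hk 3 0).add (hk 3 1)).add ((hk 0 3).add (hk 1 3))).add (hk 2 3) using 1
    ext p q
    simp [auxIndex, Fin.rev, Matrix.kroneckerMap_apply]
    ring
  · convert (((hk 2 0).add (hk 2 1)).add ((hk 2 3).add (hk 0 2))).add (hk 1 2) using 1
    ext p q
    simp [auxIndex, Fin.rev, Matrix.kroneckerMap_apply]
    ring
  · convert (((hk 1 0).add (hk 1 1)).add ((hk 1 3).add (hk 0 2))).add (hk 2 2) using 1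
    ext p q
    simp [auxIndex, Fin.rev, Matrix.kroneckerMap_apply]
    ring
  · convert (((hk 0 0).add (hk 0 1)).add ((hk 0 3).add (hk 1 2))).add (hk 2 2) using 1
    ext p q
    simp [auxIndex, Fin.rev, Matrix.kroneckerMap_apply]
    ring

theorem trace_bellProj (i : Fin 4) : (bellProj i).trace = 1 := by
  have h : ∀ a b, bellProj i (a, b) (a, b) = 1 / 2 * (pauli i b a * star (pauli i b a)) :=
    fun a b => bellProj_apply i a b a b
  simp only [Matrix.trace, Matrix.diag_apply, Fintype.sum_prod_type, Fin.sum_univ_two, h]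
  fin_cases i <;> simp [pauli] <;> norm_num

/-- The partial transpose of an operator on two bipartite systems that are grouped by system. -/
def pairTranspose {α β α' β' : Type}
    (M : Matrix ((α × β) × (α' × β')) ((α × β) × (α' × β')) ℂ) :
    Matrix ((α × β) × (α' × β')) ((α × β) × (α' × β')) ℂ :=
  Matrix.of fun p q => M ((q.1.1, p.1.2), (q.2.1, p.2.2)) ((p.1.1, q.1.2), (p.2.1, q.2.2))

/-- Partial transposition of both factors only permutes the terms M p q N q p of the trace, by an
involution of the index pairs. -/
theorem trace_mul_kronecker {α β α' β' : Type} [Fintype α] [Fintype β] [Fintype α'] [Fintype β']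
    (M : Matrix ((α × β) × (α' × β')) ((α × β) × (α' × β')) ℂ) (X : Matrix (α × β) (α × β) ℂ)
    (Y : Matrix (α' × β') (α' × β') ℂ) :
    (M * (X ⊗ₖ Y)).trace =
      (pairTranspose M * (partialTranspose X ⊗ₖ partialTranspose Y)).trace := by
  let I := (α × β) × (α' × β')
  let f : I × I → I × I := fun x =>
    (((x.2.1.1, x.1.1.2), (x.2.2.1, x.1.2.2)), ((x.1.1.1, x.2.1.2), (x.1.2.1, x.2.2.2)))
  have hf : Function.Involutive f := fun x => rfl
  simp only [Matrix.trace, Matrix.diag_apply, Matrix.mul_apply]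
  rw [← Fintype.sum_prod_type' (f := fun p q : I => M p q * (X ⊗ₖ Y) q p),
    ← Fintype.sum_prod_type' (f := fun p q : I =>
      pairTranspose M p q * (partialTranspose X ⊗ₖ partialTranspose Y) q p)]
  exact (Equiv.sum_comp hf.toPerm fun x : I × I => M x.1 x.2 * (X ⊗ₖ Y) x.2 x.1).symm

theorem trace_mul_vecMulVec_star {ι : Type} [Fintype ι] (M : Matrix ι ι ℂ) (v : ι → ℂ) :
    (M * Matrix.vecMulVec v (star v)).trace = star v ⬝ᵥ M.mulVec v := by
  rw [Matrix.mul_vecMulVec, Matrix.trace_vecMulVec, dotProduct_comm]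

theorem dotProduct_mulVec_of_injective {ι κ : Type} [Fintype ι] [Fintype κ] {g : κ → ι}
    (hg : Function.Injective g) (M : Matrix ι ι ℂ) {w : ι → ℂ} (hw : ∀ x ∉ Set.range g, w x = 0) :
    star w ⬝ᵥ M.mulVec w = star (w ∘ g) ⬝ᵥ (M.submatrix g g).mulVec (w ∘ g) := by
  refine (Fintype.sum_of_injective g hg _ _ (fun x hx => by simp [hw x hx]) fun p => ?_).symm
  congr 1
  exact Fintype.sum_of_injective g hg _ _ (fun x hx => by simp [hw x hx]) fun p => rfl

/-! ### Normalization and the decomposition of the states -/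

theorem bipTensor_dotProduct {α β α' β' : Type} [Fintype α] [Fintype β] [Fintype α'] [Fintype β']
    (ψ : α × β → ℂ) (φ : α' × β' → ℂ) :
    star (bipTensor ψ φ) ⬝ᵥ bipTensor ψ φ = (star ψ ⬝ᵥ ψ) * (star φ ⬝ᵥ φ) := by
  simp only [dotProduct, Finset.sum_mul_sum]
  rw [← Fintype.sum_prod_type' (f := fun (p : α × β) (q : α' × β') =>
    star ψ p * ψ p * (star φ q * φ q))]
  refine Fintype.sum_equiv (Equiv.prodProdProdComm _ _ _ _) _ _ fun p => ?_
  simp [bipTensor]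
  ring

theorem bell_dotProduct (i : Fin 4) : star (bell i) ⬝ᵥ bell i = 1 := by
  rw [← trace_bellProj i, bellProj, Matrix.trace_vecMulVec, dotProduct_comm]

theorem stateS_eq (i : Fin 4) : stateS i = bipTensor (bell i) (bell (auxIndex i)) := by
  fin_cases i <;> rfl

theorem stateS_dotProduct (i : Fin 4) : star (stateS i) ⬝ᵥ stateS i = 1 := by
  rw [stateS_eq, bipTensor_dotProduct, bell_dotProduct, bell_dotProduct, one_mul]

theorem ket_dotProduct (a b : Fin 2) : star (ket a b) ⬝ᵥ ket a b = 1 := by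
  simp [ket, dotProduct_single]

theorem stateK_eq (δ : ℝ) (i : Fin 4) :
    stateK δ i = ((Real.sqrt (1 - δ) : ℝ) : ℂ) • bipTensor (stateS i) (ket 0 0) +
      ((Real.sqrt δ : ℝ) : ℂ) • bipTensor (stateS i) (ket 1 1) := by
  ext p
  simp [stateK, bipTensor, stateBeta]
  ring

/-- If `0 ≤ F ≤ 1` fixes `√(1 - δ) w + √δ u`, then it almost fixes `w`. -/
theorem fidelity_of_mulVec_eq {ι : Type} [Fintype ι] [DecidableEq ι] {E : Matrix ι ι ℂ}
    (hE : E.PosSemidef) (hE1 : (1 - E).PosSemidef) {δ : ℝ} (h0 : 0 < δ) (h1 : δ < 1)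
    {w u : ι → ℂ} (hw : star w ⬝ᵥ w = 1) (hu : star u ⬝ᵥ u = 1)
    (h : E.mulVec (((Real.sqrt (1 - δ) : ℝ) : ℂ) • w + ((Real.sqrt δ : ℝ) : ℂ) • u) =
      ((Real.sqrt (1 - δ) : ℝ) : ℂ) • w + ((Real.sqrt δ : ℝ) : ℂ) • u) :
    1 - δ / (1 - δ) ≤ (star w ⬝ᵥ E.mulVec w).re := by
  set a := Real.sqrt (1 - δ)
  set b := Real.sqrt δ
  have ha : a * a = 1 - δ := Real.mul_self_sqrt (by linarith)
  have hb : b * b = δ := Real.mul_self_sqrt h0.le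
  -- 1 - E annihilates the superposition, so its quadratic forms at √(1-δ) w and at √δ u agree. The
  -- latter is at most δ.
  have hF : (1 - E).mulVec ((a : ℂ) • w) = - (1 - E).mulVec ((b : ℂ) • u) := by
    rw [eq_neg_iff_add_eq_zero, ← Matrix.mulVec_add, Matrix.sub_mulVec, h, Matrix.one_mulVec,
      sub_self]
  have hH : (1 - E).conjTranspose = 1 - E := hE1.1
  have hq : star ((a : ℂ) • w) ⬝ᵥ (1 - E).mulVec ((a : ℂ) • w) =
      star ((b : ℂ) • u) ⬝ᵥ (1 - E).mulVec ((b : ℂ) • u) := by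
    rw [hF, dotProduct_neg, Matrix.dotProduct_mulVec, ← neg_dotProduct]
    have : Matrix.vecMul (star ((a : ℂ) • w)) (1 - E) = - Matrix.vecMul (star ((b : ℂ) • u)) (1 - E) := by
      have := congrArg star hF
      rw [star_neg, Matrix.star_mulVec, Matrix.star_mulVec, hH] at this
      exact this
    rw [this, neg_neg, ← Matrix.dotProduct_mulVec]
  have key : ∀ (c : ℝ) (v : ι → ℂ), star v ⬝ᵥ v = 1 →
      star ((c : ℂ) • v) ⬝ᵥ (1 - E).mulVec ((c : ℂ) • v) =
        ((c * c : ℝ) : ℂ) * (1 - star v ⬝ᵥ E.mulVec v) := fun c v hv => by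
    rw [star_smul, Matrix.mulVec_smul, smul_dotProduct, dotProduct_smul, Matrix.sub_mulVec,
      Matrix.one_mulVec, dotProduct_sub, hv, smul_eq_mul, smul_eq_mul, ← mul_assoc]
    rw [show star (c : ℂ) = c from Complex.conj_ofReal c]
    push_cast
    ring
  rw [key a w hw, key b u hu, ha, hb] at hq
  have hre := congrArg Complex.re hq
  rw [Complex.re_ofReal_mul, Complex.re_ofReal_mul, Complex.sub_re, Complex.sub_re,
    Complex.one_re] at hre
  have hpos : 0 ≤ (star u ⬝ᵥ E.mulVec u).re := (Complex.le_def.1 (hE.dotProduct_mulVec_nonneg u)).1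
  have : 1 - (star w ⬝ᵥ E.mulVec w).re ≤ δ / (1 - δ) := by
    rw [le_div_iff₀ (by linarith)]
    nlinarith
  linarith

/-- The embedding of two pairs of qubits as those with an additional pair in the state `|00⟩`. -/
def attachKet (p : (Fin 2 × Fin 2) × (Fin 2 × Fin 2)) :
    ((Fin 2 × Fin 2) × Fin 2) × ((Fin 2 × Fin 2) × Fin 2) :=
  (((p.1.1, p.2.1), 0), ((p.1.2, p.2.2), 0))

theorem attachKet_injective : Function.Injective attachKet := by
  rintro ⟨⟨a, b⟩, c, d⟩ ⟨⟨a', b'⟩, c', d'⟩ h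
  simp only [attachKet, Prod.mk.injEq] at h ⊢
  tauto

theorem IsPOVM.one_sub_posSemidef {R ι : Type} [Fintype R] [Fintype ι] [DecidableEq ι]
    {E : R → Matrix ι ι ℂ} (hE : IsPOVM E) (r : R) : (1 - E r).PosSemidef := by
  classical
  rw [← hE.2, ← Finset.add_sum_erase _ _ (Finset.mem_univ r), add_sub_cancel_left]
  exact Matrix.posSemidef_sum _ fun s _ => hE.1 s

/-- The threshold 1/9 is where 4(1 - δ/(1-δ)) equals 7/2. -/
theorem not_pptDistinguishable_stateK {δ : ℝ} (h0 : 0 < δ) (h1 : δ < 1 / 9) :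
    ¬ PPTDistinguishable (stateK δ) := by
  rintro ⟨E, ⟨hE, hPPT⟩, hψ⟩
  let G := fun r => (E r).submatrix attachKet attachKet
  let H := fun r => (partialTranspose (E r)).submatrix attachKet attachKet
  have hH : ∀ r, (H r).PosSemidef := fun r => (hPPT r).submatrix _
  -- The attached |00⟩ has the same index 0 in rows and columns, so compression commutes with
  -- partial transposition.
  have hGH : ∀ r, pairTranspose (G r) = H r := fun r => rfl
  have hHsum : ∑ r, H r = 1 := by
    have : ∑ r, partialTranspose (E r) = 1 := by
      rw [← partialTranspose_sum, hE.2, partialTranspose_one]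
    rw [← Matrix.submatrix_one attachKet attachKet_injective, ← this]
    ext p q
    simp [H, Matrix.sum_apply]
  let T : Matrix ((Fin 2 × Fin 2) × (Fin 2 × Fin 2)) ((Fin 2 × Fin 2) × (Fin 2 × Fin 2)) ℂ :=
    (1 / 4 : ℂ) • 1 - (1 / 2 : ℂ) • bellProj 3 ⊗ₖ bellProj 2
  have hT : T.trace = 7 / 2 := by
    simp only [T, Matrix.trace_sub, Matrix.trace_smul, Matrix.trace_one, Matrix.trace_kronecker,
      trace_bellProj]
    norm_num
  have hup : ∀ r, (G r * (bellProj r ⊗ₖ bellProj (auxIndex r))).trace ≤ (H r * T).trace :=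
    fun r => by
    rw [trace_mul_kronecker, hGH, ← sub_nonneg, ← Matrix.trace_sub, ← Matrix.mul_sub]
    exact (hH r).trace_mul_nonneg (dual_posSemidef r)
  have hlow : ∀ r, 1 - δ / (1 - δ) ≤ (G r * (bellProj r ⊗ₖ bellProj (auxIndex r))).trace.re :=
    fun r => by
    have hv : bellProj r ⊗ₖ bellProj (auxIndex r) =
        Matrix.vecMulVec (bipTensor (stateS r) (ket 0 0) ∘ attachKet)
          (star (bipTensor (stateS r) (ket 0 0) ∘ attachKet)) := by
      ext p q
      simp [bellProj, Matrix.vecMulVec_apply, Matrix.kroneckerMap_apply, attachKet, stateS_eq,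
        bipTensor, ket]
      ring
    rw [hv, trace_mul_vecMulVec_star, ← dotProduct_mulVec_of_injective attachKet_injective]
    · refine fidelity_of_mulVec_eq (hE.1 r) (hE.one_sub_posSemidef r) h0 (by linarith)
        (u := bipTensor (stateS r) (ket 1 1)) ?_ ?_ ?_
      · rw [bipTensor_dotProduct, stateS_dotProduct, ket_dotProduct, one_mul]
      · rw [bipTensor_dotProduct, stateS_dotProduct, ket_dotProduct, one_mul]
      · rw [← stateK_eq]; exact hψ r
    · rintro ⟨⟨⟨a, b⟩, z⟩, ⟨a', b'⟩, z'⟩ hx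
      have : (z, z') ≠ (0, 0) := fun h => hx ⟨((a, a'), (b, b')), by
        simp only [Prod.mk.injEq] at h
        simp [attachKet, h]⟩
      simp [bipTensor, ket, this]
  have hsum : ∑ r, (G r * (bellProj r ⊗ₖ bellProj (auxIndex r))).trace ≤ 7 / 2 := by
    refine (Finset.sum_le_sum fun r _ => hup r).trans_eq ?_
    rw [← Matrix.trace_sum, ← Matrix.sum_mul, hHsum, Matrix.one_mul, hT]
  have hre := (Complex.le_def.1 hsum).1
  rw [Complex.re_sum] at hre
  have hge := Finset.sum_le_sum fun r (_ : r ∈ (Finset.univ : Finset (Fin 4))) => hlow r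
  rw [Finset.sum_const, Finset.card_univ, Fintype.card_fin, nsmul_eq_mul] at hge
  have hlt : δ / (1 - δ) < 1 / 8 := by
    rw [div_lt_iff₀ (by linarith)]
    linarith
  norm_num at hre hge
  linarith

theorem theorem3 :
    (∃ δ₀ : ℝ, 0 < δ₀ ∧ δ₀ ≤ 1 / 2 ∧ ∀ δ : ℝ, 0 < δ → δ < δ₀ →
      ¬ PPTDistinguishable (stateK δ) ∧ ¬ LOCCDistinguishable (stateK δ)) ∧
    (∀ δ : ℝ, 0 < δ → δ < 1 / 2 → ∀ m : ℕ, m = ⌈-1 / Real.logb 2 (1 - δ)⌉₊ →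
      1 < m ∧ (Set.range (bipTensorPower (stateK δ) m)).ncard = 4 ^ m ∧
        LOCCDistinguishable (bipTensorPower (stateK δ) m)) := by
  refine ⟨⟨1 / 9, by norm_num, by norm_num, fun δ h0 h1 => ?_⟩, ?_⟩
  · have h := not_pptDistinguishable_stateK h0 h1
    exact ⟨h, fun h' => h h'.pptDistinguishable⟩
  · rintro δ h0 h1 m rfl
    have hm := pow_copies_le h0 h1
    exact ⟨one_lt_copies h0 h1, ncard_range_bipTensorPower_stateK h0 h1 hm,
      locc_bipTensorPower_stateK h0 h1 hm⟩
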